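/- Let $\lambda,c_1>0$, $\beta,\gamma,c_2\ge 0$ and $\alpha\in(0,\tfrac12)$ be fixed real numbers. For $p\in\mathbb N$ put $$k=\lfloor c_1p^\alpha\rfloor,\quad L=\Big\lfloor \tfrac{2\beta k}{\lambda}\log(p-k)\Big\rfloor,\quad n=\Big\lfloor c_2\tfrac{k^\gamma}{\lambda^2}\Big\rfloor,\quad D=(\log p)^2 .$$ (Since $k/p\to0$, these are well defined for all large $p$.) Let $\mathbb Q_{L+n}$ (the null) be the law of $L+n$ i.i.d. samples $x_i=\xi_i\sim\mathcal N(0,I_p)$, and let $\mathbb P_{L+n}$ (the semi-supervised alternative) be the law of $$x_i=\mu^S+\xi_i\quad(1\le i\le L),\qquad x_i=y_i\,\mu^S+\xi_i\quad(L<i\le L+n),$$ where $S$ is uniformly distributed over the $k$-element subsets of $\{1,\dots,p\}$, $\mu^S(j)=\sqrt{\lambda/k}\,\mathbf 1\{j\in S\}$, the $y_i$ are i.i.d. Rademacher signs, the $\xi_i$ are i.i.d. $\mathcal N(0,I_p)$, and $S$, $(y_i)$, $(\xi_i)$ are independent. Define the degree-$D$ likelihood-ratio norm by $$\|\mathcal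 L_{L+n}^{\le D}\|=\max_{\deg f\le D}\frac{\mathbb E_{X\sim\mathbb P_{L+n}}[f(X)]}{\sqrt{\mathbb E_{X\sim\mathbb Q_{L+n}}[f(X)^2]}},$$ the maximum being over the nonzero real polynomials $f$ in the $(L+n)p$ entries of the data, of total degree at most $D$. If $\beta<\tfrac12-\alpha$ and $\gamma<2$, then for all large $p$ this maximum is attained, and as $p\to\infty$ $$\|\mathcal L_{L+n}^{\le D}\|^2=O(1).$$ -/

import Mathlib

open MeasureTheory ProbabilityTheory Filter Asymptotics
open scoped ENNReal

noncomputable section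

/-- Index set of the data entries: `(Sum.inl i, j)` is coordinate `j` of the `i`-th of the first
`L` samples, `(Sum.inr i, j)` is coordinate `j` of the `i`-th of the last `n` samples. -/
abbrev DataIdx (p L n : ℕ) : Type := (Fin L ⊕ Fin n) × Fin p

/-- The null distribution: `L + n` i.i.d. samples from `N(0, I_p)`, that is, all `(L + n) p` entries
are i.i.d. standard Gaussian. -/
def nullDist (p L n : ℕ) : Measure (DataIdx p L n → ℝ) :=
  Measure.pi fun _ => gaussianReal 0 1

/-- The mean vector `μ^S`, with `μ^S(j) = √(λ/k) · 1{j ∈ S}`. -/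
def meanVec (p k : ℕ) (lam : ℝ) (S : Finset (Fin p)) (j : Fin p) : ℝ :=
  if j ∈ S then Real.sqrt (lam / k) else 0

/-- The noise-free data given the support `S` and the hidden signs `y`: the mean is `μ^S` for the
first `L` samples and `y_i μ^S` for the last `n` samples. -/
def signal (p k L n : ℕ) (lam : ℝ) (S : Finset (Fin p)) (y : Fin n → ℤˣ) : DataIdx p L n → ℝ
  | (Sum.inl _, j) => meanVec p k lam S j
  | (Sum.inr i, j) => ((y i : ℤ) : ℝ) * meanVec p k lam S j

/-- The semi-supervised alternative: the law of signal plus standard Gaussian noise, where the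
support `S` is uniform over the `k`-element subsets of the `p` coordinates, the signs are i.i.d.
Rademacher (jointly uniform over the `2 ^ n` sign vectors), and `S`, the signs and the noise are
independent. -/
def altDist (p k L n : ℕ) (lam : ℝ) : Measure (DataIdx p L n → ℝ) :=
  (((p.choose k * 2 ^ n : ℕ) : ℝ≥0∞)⁻¹) •
    ∑ S ∈ (Finset.univ : Finset (Fin p)).powersetCard k, ∑ y : Fin n → ℤˣ,
      (nullDist p L n).map (fun ξ => signal p k L n lam S y + ξ)

/-- The values `E_P[f] / √(E_Q[f²])` over polynomials `f` of total degree at most `D`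
(with non-zero denominator). -/
def lowDegreeRatios {σ : Type*} (P Q : Measure (σ → ℝ)) (D : ℝ) : Set ℝ :=
  {r | ∃ f : MvPolynomial σ ℝ, (f.totalDegree : ℝ) ≤ D ∧
    (∫ x, (MvPolynomial.eval x f) ^ 2 ∂Q) ≠ 0 ∧
    r = (∫ x, MvPolynomial.eval x f ∂P) / Real.sqrt (∫ x, (MvPolynomial.eval x f) ^ 2 ∂Q)}

/-- The degree-`D` likelihood-ratio norm: the largest of these values. -/
def lowDegreeNorm {σ : Type*} (P Q : Measure (σ → ℝ)) (D : ℝ) : ℝ :=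
  sSup (lowDegreeRatios P Q D)

end

/-! Conditionally on the support and the signs, the alternative is a standard Gaussian shifted by a
signal `s`. The degree-`N` part of the likelihood ratio of such a shift has an explicit Hermite
expansion (`shiftLR`), and integrating against it reproduces the shifted mean of every polynomial of
degree at most `N` (`integral_mul_shiftLR`). By Cauchy–Schwarz the average of these expansions over
`s` is the optimal polynomial (`isGreatest_lowDegreeRatios`). The squared norm is then the average
over two independent signals `s`, `s'` of the exponential series of `⟨s, s'⟩` cut after degree `N`.

Here `⟨s, s'⟩` is `tλ/k` times `L` plus a sum of `n` random signs, where `t` is the overlap of the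
two supports. An overlap `t` has probability at most `(k²/p)^t / t!`, which is of order
`p^{-(1-2α)t} / t!` up to a factor `c₁^{2t}`. This has to absorb the truncated moment generating
function of the sign sum (`overlap_term_le`). The threshold is `K = k^{2-γ}`. For `t ≤ K` the
untruncated function suffices: the labelled samples cost `p^{2βt}` with `2β < 1 - 2α`, the
unlabelled ones only `exp(c₂t/2)`. For `t ≥ K` that Gaussian bound is too weak, and the truncation
enters: scaling the argument by `t` costs at most `t^N ≤ exp(log³ p)`, which `p^{(1-2α)K}` dominates
because `K` is a positive power of `p`. What remains is bounded by an exponential series in `t`. -/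

namespace LowDegree
-- One-dimensional Gaussian integrals and Hermite polynomials.
section Gaussian
open Polynomial

lemma integrable_eval_gaussianReal (q : ℝ[X]) :
    Integrable (fun x => q.eval x) (gaussianReal 0 1) := by
  simp_rw [eval_eq_sum_range]
  refine integrable_finsetSum _ fun i _ => Integrable.const_mul ?_ _
  have h := (memLp_id_gaussianReal (μ := 0) (v := 1) (i : NNReal)).integrable_norm_pow'
  refine (integrable_norm_iff (by fun_prop)).1 ?_
  simpa [norm_pow] using h

lemma integrable_pdf_mul_eval (q : ℝ[X]) :
    Integrable (fun x => gaussianPDFReal 0 1 x * q.eval x) := by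
  have h := integrable_eval_gaussianReal q
  rw [gaussianReal_of_var_ne_zero 0 one_ne_zero,
    integrable_withDensity_iff_integrable_smul₀' (by fun_prop)
      (by simp [gaussianPDF_def])] at h
  simpa using h

lemma hasDerivAt_gaussianPDFReal (x : ℝ) :
    HasDerivAt (gaussianPDFReal 0 1) (-(x * gaussianPDFReal 0 1 x)) x := by
  have h : HasDerivAt (fun x : ℝ => (√(2 * Real.pi))⁻¹ * Real.exp (-x ^ 2 / 2))
      ((√(2 * Real.pi))⁻¹ * (Real.exp (-x ^ 2 / 2) * (-(2 * x) / 2))) x := by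
    have h1 : HasDerivAt (fun x : ℝ => -x ^ 2 / 2) (-(2 * x) / 2) x := by
      simpa using ((hasDerivAt_pow 2 x).neg.div_const 2)
    exact (h1.exp).const_mul _
  have e : gaussianPDFReal 0 1 = fun x : ℝ => (√(2 * Real.pi))⁻¹ * Real.exp (-x ^ 2 / 2) := by
    ext x; simp [gaussianPDFReal]
  rw [e]
  convert h using 1
  ring

/-- Gaussian integration by parts for polynomials. -/
lemma integral_X_mul_gaussianReal (q : ℝ[X]) :
    ∫ x, (X * q).eval x ∂gaussianReal 0 1 = ∫ x, (derivative q).eval x ∂gaussianReal 0 1 := by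
  rw [integral_gaussianReal_eq_integral_smul one_ne_zero,
    integral_gaussianReal_eq_integral_smul one_ne_zero]
  have h := integral_mul_deriv_eq_deriv_mul_of_integrable
    (u := fun x => q.eval x) (u' := fun x => (derivative q).eval x)
    (v := gaussianPDFReal 0 1) (v' := fun x => -(x * gaussianPDFReal 0 1 x))
    (fun x _ => q.hasDerivAt x) (fun x _ => hasDerivAt_gaussianPDFReal x)
    (by
      refine (integrable_pdf_mul_eval (X * q)).neg.congr (ae_of_all _ fun x => ?_)
      simp; ring)
    (by
      refine (integrable_pdf_mul_eval (derivative q)).congr (ae_of_all _ fun x => ?_)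
      simp; ring)
    (by
      refine (integrable_pdf_mul_eval q).congr (ae_of_all _ fun x => ?_)
      simp; ring)
  calc ∫ x, gaussianPDFReal 0 1 x • (X * q).eval x
      = -∫ x, q.eval x * -(x * gaussianPDFReal 0 1 x) := by
        rw [← integral_neg]; congr 1; ext x; simp; ring
    _ = ∫ x, gaussianPDFReal 0 1 x • (derivative q).eval x := by
        rw [h, neg_neg]; congr 1; ext x; simp; ring

/-- The probabilists' Hermite polynomial with real coefficients. -/
noncomputable def realHermite (a : ℕ) : ℝ[X] := (hermite a).map (Int.castRingHom ℝ)

lemma realHermite_zero : realHermite 0 = 1 := by simp [realHermite]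

lemma realHermite_succ (a : ℕ) :
    realHermite (a + 1) = X * realHermite a - derivative (realHermite a) := by
  simp [realHermite, hermite_succ, derivative_map]

lemma natDegree_realHermite_le (a : ℕ) : (realHermite a).natDegree ≤ a :=
  natDegree_map_le.trans natDegree_hermite.le

lemma integral_eval_add (p q : ℝ[X]) : ∫ x, (p + q).eval x ∂gaussianReal 0 1 =
    ∫ x, p.eval x ∂gaussianReal 0 1 + ∫ x, q.eval x ∂gaussianReal 0 1 := by
  simp_rw [eval_add]
  exact integral_add (integrable_eval_gaussianReal p) (integrable_eval_gaussianReal q)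

/-- Iterated integration by parts: by the Hermite recursion, each step trades one Hermite index for
one derivative of `f`. -/
lemma integral_mul_realHermite (a : ℕ) (f : ℝ[X]) :
    ∫ x, (f * realHermite a).eval x ∂gaussianReal 0 1 =
      ∫ x, (derivative^[a] f).eval x ∂gaussianReal 0 1 := by
  induction a generalizing f with
  | zero => simp [realHermite_zero]
  | succ a ih =>
    have h := integral_X_mul_gaussianReal (f * realHermite a)
    rw [derivative_mul, integral_eval_add, ih] at h
    have e : X * (f * realHermite a) =
        f * realHermite (a + 1) + f * derivative (realHermite a) := by
      rw [realHermite_succ]; ring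
    rw [e, integral_eval_add] at h
    rw [Function.iterate_succ_apply]
    linarith

lemma integral_pow_mul_realHermite (a m : ℕ) :
    ∫ x, x ^ m * (realHermite a).eval x ∂gaussianReal 0 1 =
      m.descFactorial a * ∫ x, x ^ (m - a) ∂gaussianReal 0 1 := by
  have h := integral_mul_realHermite a (X ^ m)
  rw [iterate_derivative_X_pow_eq_smul] at h
  simpa [integral_const_mul] using h

/-- The Hermite series of the likelihood ratio of a shift by `s`, with coefficients `s ^ a / a!`,
tested on a monomial. It is the binomial theorem; indices above `m` are absent because those Hermite
polynomials are orthogonal to `x ^ m`. -/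
lemma sum_pow_div_factorial_mul_integral (s : ℝ) (m : ℕ) :
    ∑ a ∈ Finset.range (m + 1), s ^ a / a.factorial *
      ∫ x, x ^ m * (realHermite a).eval x ∂gaussianReal 0 1 =
      ∫ x, (s + x) ^ m ∂gaussianReal 0 1 := by
  simp_rw [integral_pow_mul_realHermite, add_pow]
  rw [integral_finsetSum]
  · refine Finset.sum_congr rfl fun a _ => ?_
    rw [integral_mul_const, integral_const_mul, Nat.choose_eq_descFactorial_div_factorial,
      Nat.cast_div (Nat.factorial_dvd_descFactorial _ _) (by positivity)]
    ring
  · intro a _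
    have := integrable_eval_gaussianReal (X ^ (m - a))
    simp only [eval_pow, eval_X] at this
    exact (this.const_mul _).mul_const _

lemma integral_pow_mul_realHermite_of_lt {a m : ℕ} (h : m < a) :
    ∫ x, x ^ m * (realHermite a).eval x ∂gaussianReal 0 1 = 0 := by
  rw [integral_pow_mul_realHermite, Nat.descFactorial_of_lt h]; simp

/-- In the Hermite recursion at `s + x`, integration by parts cancels the `x` term against the
derivative term, so each index contributes one factor `s`. -/
lemma integral_realHermite_shift (a : ℕ) (s : ℝ) :
    ∫ x, (realHermite a).eval (s + x) ∂gaussianReal 0 1 = s ^ a := by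
  induction a with
  | zero => simp [realHermite_zero]
  | succ a ih =>
    set r := (realHermite a).comp (C s + X) with hr
    have h := integral_X_mul_gaussianReal r
    have hd : derivative r = (derivative (realHermite a)).comp (C s + X) := by
      simp [hr, derivative_comp]
    have e : (realHermite (a + 1)).comp (C s + X) + derivative r = C s * r + X * r := by
      rw [hd, hr, realHermite_succ]; simp; ring
    have e' := congrArg (fun q : ℝ[X] => ∫ x, q.eval x ∂gaussianReal 0 1) e
    simp only [integral_eval_add] at e'
    have h1 : ∫ x, (C s * r).eval x ∂gaussianReal 0 1 = s ^ (a + 1) := by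
      simp [hr, integral_const_mul, ih, pow_succ']
    rw [h1, h] at e'
    simpa using e'

end Gaussian

/-! ### Product Hermite polynomials and the projected likelihood ratio of one shift. -/

section Multivariate
variable {σ : Type*} [Fintype σ]

/-- The standard Gaussian measure on `σ → ℝ`. -/
noncomputable abbrev gaussPi (σ : Type*) [Fintype σ] : Measure (σ → ℝ) :=
  Measure.pi fun _ => gaussianReal 0 1

lemma integrable_prod_eval (q : σ → Polynomial ℝ) :
    Integrable (fun x => ∏ i, (q i).eval (x i)) (gaussPi σ) :=
  Integrable.fintype_prod (f := fun i y => (q i).eval y) fun i => integrable_eval_gaussianReal (q i)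

lemma integrable_prod_shift_pow (s : σ → ℝ) (m : σ → ℕ) :
    Integrable (fun x => ∏ i, (s + x) i ^ m i) (gaussPi σ) := by
  have h := integrable_prod_eval (σ := σ) (fun i => (Polynomial.C (s i) + Polynomial.X) ^ m i)
  simpa only [Pi.add_apply, Polynomial.eval_pow, Polynomial.eval_add, Polynomial.eval_C,
    Polynomial.eval_X] using h

lemma integral_prod_eval (q : σ → Polynomial ℝ) :
    ∫ x, ∏ i, (q i).eval (x i) ∂gaussPi σ = ∏ i, ∫ x, (q i).eval x ∂gaussianReal 0 1 :=
  integral_fintype_prod_eq_prod (fun i y => (q i).eval y)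

lemma integrable_eval (f : MvPolynomial σ ℝ) :
    Integrable (fun x => MvPolynomial.eval x f) (gaussPi σ) := by
  simp_rw [MvPolynomial.eval_eq']
  refine integrable_finsetSum _ fun d _ => Integrable.const_mul ?_ _
  simpa using integrable_prod_eval (σ := σ) (fun i => Polynomial.X ^ d i)

lemma integrable_eval_shift (f : MvPolynomial σ ℝ) (s : σ → ℝ) :
    Integrable (fun x => MvPolynomial.eval (s + x) f) (gaussPi σ) := by
  simp_rw [MvPolynomial.eval_eq']
  refine integrable_finsetSum _ fun d _ => Integrable.const_mul ?_ _
  exact integrable_prod_shift_pow s d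

/-- The product Hermite polynomial with multi-index `a`. -/
noncomputable def hermiteProd (a : σ → ℕ) : MvPolynomial σ ℝ :=
  ∏ i, (realHermite (a i)).toMvPolynomial i

lemma eval_hermiteProd (a : σ → ℕ) (x : σ → ℝ) :
    MvPolynomial.eval x (hermiteProd a) = ∏ i, (realHermite (a i)).eval (x i) := by
  simp [hermiteProd, map_prod, MvPolynomial.eval_toMvPolynomial]

omit [Fintype σ] in
lemma totalDegree_toMvPolynomial_le (q : Polynomial ℝ) (i : σ) :
    (q.toMvPolynomial i : MvPolynomial σ ℝ).totalDegree ≤ q.natDegree := by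
  have e : (q.toMvPolynomial i : MvPolynomial σ ℝ) =
      ∑ j ∈ Finset.range (q.natDegree + 1),
        MvPolynomial.C (q.coeff j) * MvPolynomial.X i ^ j := by
    conv_lhs => rw [q.as_sum_range_C_mul_X_pow]
    simp [map_sum, Polynomial.toMvPolynomial]
  rw [e]
  refine MvPolynomial.totalDegree_finsetSum_le fun j hj => ?_
  refine (MvPolynomial.totalDegree_mul _ _).trans ?_
  rw [MvPolynomial.totalDegree_C, MvPolynomial.totalDegree_X_pow, zero_add]
  exact Nat.lt_succ_iff.1 (Finset.mem_range.1 hj)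

lemma totalDegree_hermiteProd_le (a : σ → ℕ) : (hermiteProd a).totalDegree ≤ ∑ i, a i :=
  (MvPolynomial.totalDegree_finsetProd _ _).trans <| Finset.sum_le_sum fun i _ =>
    (totalDegree_toMvPolynomial_le _ i).trans (natDegree_realHermite_le _)

lemma integral_monomial_mul_hermiteProd (m a : σ → ℕ) :
    ∫ x, (∏ i, x i ^ m i) * MvPolynomial.eval x (hermiteProd a) ∂gaussPi σ =
      ∏ i, ∫ x, x ^ m i * (realHermite (a i)).eval x ∂gaussianReal 0 1 := by
  simp_rw [eval_hermiteProd, ← Finset.prod_mul_distrib]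
  exact integral_fintype_prod_eq_prod
    (fun i (y : ℝ) => y ^ m i * (realHermite (a i)).eval y)

lemma integrable_monomial_mul_eval (m : σ → ℕ) (f : MvPolynomial σ ℝ) :
    Integrable (fun x => (∏ i, x i ^ m i) * MvPolynomial.eval x f) (gaussPi σ) := by
  have h := integrable_eval ((∏ i, MvPolynomial.X i ^ m i) * f)
  simpa only [map_mul, map_prod, map_pow, MvPolynomial.eval_X] using h

variable [DecidableEq σ]

/-- The projection onto degree at most `N` of the likelihood ratio of a Gaussian shifted by `s`. -/
noncomputable def shiftLR (N : ℕ) (s : σ → ℝ) : MvPolynomial σ ℝ :=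
  ∑ d ∈ Finset.range (N + 1), ∑ a ∈ Finset.piAntidiag Finset.univ d,
    MvPolynomial.C (∏ i, s i ^ a i / (a i).factorial) * hermiteProd a

lemma totalDegree_shiftLR_le (N : ℕ) (s : σ → ℝ) : (shiftLR N s).totalDegree ≤ N := by
  refine MvPolynomial.totalDegree_finsetSum_le fun d hd =>
    MvPolynomial.totalDegree_finsetSum_le fun a ha => ?_
  refine (MvPolynomial.totalDegree_mul _ _).trans ?_
  rw [MvPolynomial.totalDegree_C, zero_add]
  refine (totalDegree_hermiteProd_le a).trans ?_
  rw [(Finset.mem_piAntidiag.1 ha).1]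
  exact Nat.lt_succ_iff.1 (Finset.mem_range.1 hd)

lemma integral_monomial_mul_shiftLR {N : ℕ} {m : σ → ℕ} (hm : ∑ i, m i ≤ N) (s : σ → ℝ) :
    ∫ x, (∏ i, x i ^ m i) * MvPolynomial.eval x (shiftLR N s) ∂gaussPi σ =
      ∫ x, ∏ i, (s i + x i) ^ m i ∂gaussPi σ := by
  set F : (σ → ℕ) → ℝ := fun a => ∏ i, s i ^ a i / (a i).factorial *
    ∫ x, x ^ m i * (realHermite (a i)).eval x ∂gaussianReal 0 1 with hF
  have lhs : ∫ x, (∏ i, x i ^ m i) * MvPolynomial.eval x (shiftLR N s) ∂gaussPi σ =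
      ∑ d ∈ Finset.range (N + 1), ∑ a ∈ Finset.piAntidiag Finset.univ d, F a := by
    simp_rw [shiftLR, map_sum, map_mul, MvPolynomial.eval_C, Finset.mul_sum,
      mul_left_comm (∏ i, _ ^ m i)]
    rw [integral_finsetSum]
    · refine Finset.sum_congr rfl fun d _ => ?_
      rw [integral_finsetSum]
      · refine Finset.sum_congr rfl fun a _ => ?_
        rw [integral_const_mul, integral_monomial_mul_hermiteProd, ← Finset.prod_mul_distrib]
      · exact fun a _ => (integrable_monomial_mul_eval m _).const_mul _
    · exact fun d _ => integrable_finsetSum _ fun a _ =>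
        (integrable_monomial_mul_eval m _).const_mul _
  have rhs : ∫ x, ∏ i, (s i + x i) ^ m i ∂gaussPi σ =
      ∑ a ∈ Fintype.piFinset fun i => Finset.range (m i + 1), F a := by
    have h := integral_prod_eval (σ := σ)
      (fun i => (Polynomial.C (s i) + Polynomial.X) ^ m i)
    simp only [Polynomial.eval_pow, Polynomial.eval_add, Polynomial.eval_C,
      Polynomial.eval_X] at h
    have h' := Finset.prod_univ_sum (fun i => Finset.range (m i + 1)) fun i a =>
      s i ^ a / a.factorial * ∫ x, x ^ m i * (realHermite a).eval x ∂gaussianReal 0 1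
    rw [h, ← h']
    exact Finset.prod_congr rfl fun i _ => (sum_pow_div_factorial_mul_integral (s i) (m i)).symm
  have hle : ∀ a : σ → ℕ, a ∈ (Fintype.piFinset fun i => Finset.range (m i + 1)) ↔ a ≤ m := by
    intro a
    simp [Fintype.mem_piFinset, Pi.le_def]
  -- The box `a ≤ m` is sliced by total degree. Since `∑ m ≤ N`, every slice is kept by the
  -- truncation; multi-indices outside the box contribute zero by orthogonality.
  rw [lhs, rhs, ← Finset.sum_fiberwise_of_maps_to (t := Finset.range (N + 1))
    (g := fun a : σ → ℕ => ∑ i, a i)]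
  · refine Finset.sum_congr rfl fun d _ => (Finset.sum_subset ?_ ?_).symm
    · intro a ha
      simpa [Finset.mem_piAntidiag] using (Finset.mem_filter.1 ha).2
    · intro a ha hna
      have had : ∑ i, a i = d := (Finset.mem_piAntidiag.1 ha).1
      have : ¬ a ≤ m := fun h => hna (Finset.mem_filter.2 ⟨(hle a).2 h, had⟩)
      obtain ⟨i, hi⟩ := not_forall.1 this
      refine Finset.prod_eq_zero (Finset.mem_univ i) ?_
      rw [integral_pow_mul_realHermite_of_lt (not_le.1 hi), mul_zero]
  · intro a ha
    exact Finset.mem_range.2 (Nat.lt_succ_of_le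
      ((Finset.sum_le_sum fun i _ => (hle a).1 ha i).trans hm))

/-- Reproducing property of the projected likelihood ratio. -/
lemma integral_mul_shiftLR {N : ℕ} {f : MvPolynomial σ ℝ} (hf : f.totalDegree ≤ N) (s : σ → ℝ) :
    ∫ x, MvPolynomial.eval x f * MvPolynomial.eval x (shiftLR N s) ∂gaussPi σ =
      ∫ x, MvPolynomial.eval (s + x) f ∂gaussPi σ := by
  simp_rw [MvPolynomial.eval_eq' _ f, Finset.sum_mul, mul_assoc]
  rw [integral_finsetSum, integral_finsetSum]
  · refine Finset.sum_congr rfl fun m hm => ?_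
    rw [integral_const_mul, integral_const_mul, integral_monomial_mul_shiftLR]
    · rfl
    · refine le_trans ?_ ((MvPolynomial.le_totalDegree hm).trans hf)
      rw [Finsupp.sum_fintype _ _ (by simp)]
  · intro m _
    refine Integrable.const_mul ?_ _
    exact integrable_prod_shift_pow s m
  · exact fun m _ => (integrable_monomial_mul_eval m _).const_mul _

/-- By the multinomial theorem, the degree-`d` Hermite terms assemble into `⟨s, t⟩ ^ d / d!`. -/
lemma integral_shiftLR_shift (N : ℕ) (s t : σ → ℝ) :
    ∫ x, MvPolynomial.eval (s + x) (shiftLR N t) ∂gaussPi σ =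
      ∑ d ∈ Finset.range (N + 1), (∑ i, s i * t i) ^ d / d.factorial := by
  have hH : ∀ a : σ → ℕ,
      ∫ x, MvPolynomial.eval (s + x) (hermiteProd a) ∂gaussPi σ = ∏ i, s i ^ a i := by
    intro a
    simp_rw [eval_hermiteProd, Pi.add_apply]
    refine (integral_fintype_prod_eq_prod
      (fun i (y : ℝ) => (realHermite (a i)).eval (s i + y))).trans ?_
    exact Finset.prod_congr rfl fun i _ => integral_realHermite_shift _ _
  simp_rw [shiftLR, map_sum, map_mul, MvPolynomial.eval_C]
  rw [integral_finsetSum]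
  · refine Finset.sum_congr rfl fun d _ => ?_
    rw [integral_finsetSum]
    · rw [Finset.sum_pow_eq_sum_piAntidiag, Finset.sum_div]
      refine Finset.sum_congr rfl fun a ha => ?_
      have h := Nat.multinomial_spec Finset.univ a
      rw [(Finset.mem_piAntidiag.1 ha).1] at h
      rw [integral_const_mul, hH, Finset.prod_div_distrib, ← h]
      have h0 : ((∏ i, (a i).factorial : ℕ) : ℝ) ≠ 0 := by
        exact_mod_cast Finset.prod_ne_zero_iff.2 fun i _ => Nat.factorial_ne_zero _
      have h1 : (Nat.multinomial Finset.univ a : ℝ) ≠ 0 := by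
        exact_mod_cast (Nat.multinomial_pos _ _).ne'
      simp_rw [mul_pow, Finset.prod_mul_distrib]
      push_cast at h0 ⊢
      field_simp
    · exact fun a _ => (integrable_eval_shift _ _).const_mul _
  · exact fun d _ => integrable_finsetSum _ fun a _ => (integrable_eval_shift _ _).const_mul _

/-! ### Uniform mixtures of shifts and optimality of the projected likelihood ratio. -/

section Mixture
variable {ι : Type*} (Ω : Finset ι) (s : ι → σ → ℝ)

omit [DecidableEq σ] in
lemma integral_shift_mixture (f : MvPolynomial σ ℝ) :
    ∫ x, MvPolynomial.eval x f ∂((Ω.card : ℝ≥0∞)⁻¹ •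
        ∑ ω ∈ Ω, (gaussPi σ).map (fun ξ => s ω + ξ)) =
      (Ω.card : ℝ)⁻¹ * ∑ ω ∈ Ω, ∫ x, MvPolynomial.eval (s ω + x) f ∂gaussPi σ := by
  have hm : ∀ ω, AEMeasurable (fun ξ => s ω + ξ) (gaussPi σ) := fun ω => by fun_prop
  have hc : Continuous fun x : σ → ℝ => MvPolynomial.eval x f := MvPolynomial.continuous_eval f
  rw [integral_smul_measure, integral_finsetSum_measure]
  · simp only [ENNReal.toReal_inv, ENNReal.toReal_natCast, smul_eq_mul]
    congr 1
    exact Finset.sum_congr rfl fun ω _ => integral_map (hm ω) hc.aestronglyMeasurable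
  · exact fun ω _ => (integrable_map_measure hc.aestronglyMeasurable (hm ω)).2
      (integrable_eval_shift f (s ω))

/-- The projected likelihood ratio of a uniform mixture of shifted Gaussians. -/
noncomputable def mixtureLR (N : ℕ) : MvPolynomial σ ℝ :=
  MvPolynomial.C (Ω.card : ℝ)⁻¹ * ∑ ω ∈ Ω, shiftLR N (s ω)

lemma totalDegree_mixtureLR_le (N : ℕ) : (mixtureLR Ω s N).totalDegree ≤ N := by
  refine (MvPolynomial.totalDegree_mul _ _).trans ?_
  rw [MvPolynomial.totalDegree_C, zero_add]
  exact MvPolynomial.totalDegree_finsetSum_le fun ω _ => totalDegree_shiftLR_le N _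

lemma integral_mul_mixtureLR {N : ℕ} {f : MvPolynomial σ ℝ} (hf : f.totalDegree ≤ N) :
    ∫ x, MvPolynomial.eval x f * MvPolynomial.eval x (mixtureLR Ω s N) ∂gaussPi σ =
      ∫ x, MvPolynomial.eval x f ∂((Ω.card : ℝ≥0∞)⁻¹ •
        ∑ ω ∈ Ω, (gaussPi σ).map (fun ξ => s ω + ξ)) := by
  rw [integral_shift_mixture]
  simp_rw [mixtureLR, map_mul, map_sum, MvPolynomial.eval_C, mul_left_comm _ (_⁻¹ : ℝ),
    Finset.mul_sum]
  rw [← Finset.mul_sum, ← Finset.sum_congr rfl fun ω _ => integral_mul_shiftLR hf (s ω),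
    ← integral_finsetSum, ← integral_const_mul]
  · simp_rw [Finset.mul_sum]
  · intro ω _
    simpa using integrable_eval (f * shiftLR N (s ω))

/-- The reproducing property applied to the projected likelihood ratio itself gives a double average
over two independent signals. -/
lemma integral_mixtureLR_sq (N : ℕ) :
    ∫ x, MvPolynomial.eval x (mixtureLR Ω s N) ^ 2 ∂gaussPi σ =
      (Ω.card : ℝ)⁻¹ * ∑ ω ∈ Ω, ((Ω.card : ℝ)⁻¹ * ∑ ω' ∈ Ω,
        ∑ d ∈ Finset.range (N + 1), (∑ i, s ω i * s ω' i) ^ d / d.factorial) := by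
  simp_rw [pow_two (MvPolynomial.eval _ _)]
  rw [integral_mul_mixtureLR Ω s (totalDegree_mixtureLR_le Ω s N), integral_shift_mixture]
  congr 1
  refine Finset.sum_congr rfl fun ω _ => ?_
  simp_rw [mixtureLR, map_mul, map_sum, MvPolynomial.eval_C]
  rw [integral_const_mul, integral_finsetSum _ fun ω' _ => integrable_eval_shift _ _]
  simp_rw [integral_shiftLR_shift]

omit [DecidableEq σ] in
lemma integral_mul_le_sqrt (f g : MvPolynomial σ ℝ) :
    ∫ x, MvPolynomial.eval x f * MvPolynomial.eval x g ∂gaussPi σ ≤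
      √(∫ x, MvPolynomial.eval x f ^ 2 ∂gaussPi σ) *
        √(∫ x, MvPolynomial.eval x g ^ 2 ∂gaussPi σ) := by
  have hf := integrable_eval (f ^ 2)
  have hg := integrable_eval (g ^ 2)
  have hfg := integrable_eval (f * g)
  simp only [map_mul, map_pow] at hf hg hfg
  set A := ∫ x, MvPolynomial.eval x f ^ 2 ∂gaussPi σ
  set B := ∫ x, MvPolynomial.eval x f * MvPolynomial.eval x g ∂gaussPi σ
  set G := ∫ x, MvPolynomial.eval x g ^ 2 ∂gaussPi σ
  have key : ∀ t : ℝ, 0 ≤ A * (t * t) + (2 * B) * t + G := by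
    intro t
    have h : 0 ≤ ∫ x, (t * MvPolynomial.eval x f + MvPolynomial.eval x g) ^ 2 ∂gaussPi σ :=
      integral_nonneg fun x => sq_nonneg _
    have e : ∀ x : σ → ℝ, (t * MvPolynomial.eval x f + MvPolynomial.eval x g) ^ 2 =
        (t * t) * MvPolynomial.eval x f ^ 2 +
          (2 * t) * (MvPolynomial.eval x f * MvPolynomial.eval x g) +
          MvPolynomial.eval x g ^ 2 := fun x => by ring
    simp_rw [e] at h
    have hs := integral_add ((hf.const_mul (t * t)).add (hfg.const_mul (2 * t))) hg
    simp only [Pi.add_apply] at hs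
    rw [hs, integral_add (hf.const_mul _) (hfg.const_mul _), integral_const_mul,
      integral_const_mul] at h
    linarith
  have hd := discrim_le_zero key
  rw [← Real.sqrt_mul (integral_nonneg fun x => sq_nonneg _)]
  refine Real.le_sqrt_of_sq_le ?_
  rw [discrim] at hd
  linarith

/-- The low-degree likelihood-ratio norm of a uniform mixture of shifted Gaussians is attained at
the projected likelihood ratio. -/
theorem isGreatest_lowDegreeRatios (hΩ : Ω.Nonempty) {D : ℝ} (hD : 0 ≤ D) :
    IsGreatest (lowDegreeRatios ((Ω.card : ℝ≥0∞)⁻¹ •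
        ∑ ω ∈ Ω, (gaussPi σ).map (fun ξ => s ω + ξ)) (gaussPi σ) D)
      √(∫ x, MvPolynomial.eval x (mixtureLR Ω s ⌊D⌋₊) ^ 2 ∂gaussPi σ) := by
  set g := mixtureLR Ω s ⌊D⌋₊ with hg
  have hgd : g.totalDegree ≤ ⌊D⌋₊ := totalDegree_mixtureLR_le Ω s _
  constructor
  -- Testing against `1` shows that `g` has mean one, so its second moment is nonzero and `g` is
  -- admissible.
  · have h1 := integral_mul_mixtureLR Ω s (N := ⌊D⌋₊) (f := 1) (by simp)
    rw [integral_shift_mixture] at h1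
    have hc : (Ω.card : ℝ) ≠ 0 := by exact_mod_cast hΩ.card_pos.ne'
    simp only [map_one, one_mul, integral_const, probReal_univ, smul_eq_mul, mul_one,
      Finset.sum_const, nsmul_eq_mul, inv_mul_cancel₀ hc] at h1
    have hne : ∫ x, MvPolynomial.eval x g ^ 2 ∂gaussPi σ ≠ 0 := by
      intro h0
      have := integral_mul_le_sqrt 1 g
      rw [h0, Real.sqrt_zero, mul_zero] at this
      simp only [map_one, one_mul] at this
      rw [h1] at this
      linarith
    refine ⟨g, (Nat.le_floor_iff hD).1 hgd, hne, ?_⟩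
    rw [← integral_mul_mixtureLR Ω s hgd, ← hg]
    simp_rw [← pow_two]
    rw [Real.div_sqrt]
  · rintro r ⟨f, hfD, hf0, rfl⟩
    have hpos : 0 < ∫ x, MvPolynomial.eval x f ^ 2 ∂gaussPi σ :=
      lt_of_le_of_ne (integral_nonneg fun x => sq_nonneg _) hf0.symm
    rw [← integral_mul_mixtureLR Ω s (Nat.le_floor hfD), div_le_iff₀ (Real.sqrt_pos.2 hpos),
      mul_comm (√_)]
    exact integral_mul_le_sqrt f g

end Mixture
end Multivariate

/-! ### The overlap of two `k`-subsets. -/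

section Overlap

/-- A uniform `k`-subset contains `t` given points with probability `∏ (k - i)/(p - i)` over `i <
t`, and each factor is at most `k/p`. -/
lemma choose_sub_sub_le {p k t : ℕ} (hp : 0 < p) (htk : t ≤ k) (hkp : k ≤ p) :
    ((p - t).choose (k - t) : ℝ) ≤ p.choose k * ((k : ℝ) / p) ^ t := by
  induction t with
  | zero => simp
  | succ t ih =>
    have h := ih (by omega)
    have hs := Nat.add_one_mul_choose_eq (p - (t + 1)) (k - (t + 1))
    rw [show p - (t + 1) + 1 = p - t by omega, show k - (t + 1) + 1 = k - t by omega] at hs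
    have hs' : ((p : ℝ) - t) * (p - (t + 1)).choose (k - (t + 1)) =
        (p - t).choose (k - t) * ((k : ℝ) - t) := by
      rw [← Nat.cast_sub (by omega : t ≤ p), ← Nat.cast_sub (by omega : t ≤ k)]
      exact_mod_cast hs
    have hpt : (0 : ℝ) < (p : ℝ) - t := by
      rw [sub_pos]; exact_mod_cast (by omega : t < p)
    have hkp' : (k : ℝ) ≤ p := by exact_mod_cast hkp
    have hp' : (0 : ℝ) < p := by exact_mod_cast hp
    have hfrac : ((k : ℝ) - t) / ((p : ℝ) - t) ≤ k / p := by
      rw [div_le_div_iff₀ hpt hp']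
      nlinarith [(Nat.cast_nonneg t : (0 : ℝ) ≤ t)]
    have e : ((p - (t + 1)).choose (k - (t + 1)) : ℝ) =
        (p - t).choose (k - t) * (((k : ℝ) - t) / ((p : ℝ) - t)) := by
      field_simp
      linarith
    rw [e, pow_succ, ← mul_assoc]
    exact mul_le_mul h hfrac
      (div_nonneg (by rw [sub_nonneg]; exact_mod_cast (by omega : t ≤ k)) hpt.le) (by positivity)

/-- Tail bound for the hypergeometric overlap of two `k`-subsets, in counting form. -/
lemma card_filter_card_inter_le {p k t : ℕ} (hp : 0 < p) (htk : t ≤ k) (hkp : k ≤ p)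
    {T : Finset (Fin p)} (hT : T.card = k) :
    ((((Finset.univ : Finset (Fin p)).powersetCard k).filter
      fun S => (T ∩ S).card = t).card : ℝ) ≤
      p.choose k * (((k : ℝ) ^ 2 / p) ^ t / t.factorial) := by
  -- Union bound over the possible intersections `A = T ∩ S`, keeping only the condition `A ⊆ S`.
  have hsub : (((Finset.univ : Finset (Fin p)).powersetCard k).filter
      fun S => (T ∩ S).card = t) ⊆ (T.powersetCard t).biUnion fun A =>
        ((Finset.univ : Finset (Fin p)).powersetCard k).filter (A ⊆ ·) := by
    intro S hS
    rw [Finset.mem_filter] at hS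
    exact Finset.mem_biUnion.2 ⟨T ∩ S,
      Finset.mem_powersetCard.2 ⟨Finset.inter_subset_left, hS.2⟩,
      Finset.mem_filter.2 ⟨hS.1, Finset.inter_subset_right⟩⟩
  have hcard : (((Finset.univ : Finset (Fin p)).powersetCard k).filter
      fun S => (T ∩ S).card = t).card ≤ k.choose t * (p - t).choose (k - t) := by
    refine (Finset.card_le_card hsub).trans (Finset.card_biUnion_le.trans ?_)
    rw [Finset.sum_congr rfl (g := fun _ => (p - t).choose (k - t)), Finset.sum_const,
      Finset.card_powersetCard, hT, smul_eq_mul]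
    intro A hA
    rw [Finset.mem_powersetCard] at hA
    rw [Finset.card_filter_powersetCard_subset, Finset.card_univ, Fintype.card_fin, hA.2]
    all_goals simp [hA.2, htk]
  calc _ ≤ ((k.choose t * (p - t).choose (k - t) : ℕ) : ℝ) := by exact_mod_cast hcard
    _ ≤ ((k : ℝ) ^ t / t.factorial) * (p.choose k * ((k : ℝ) / p) ^ t) := by
        push_cast
        exact mul_le_mul (Nat.choose_le_pow_div t k) (choose_sub_sub_le hp htk hkp)
          (by positivity) (by positivity)
    _ = _ := by
        rw [pow_two, mul_div_assoc, mul_pow]; ring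

end Overlap

/-! ### Moments of sums of random signs. -/

section Signs
variable (n : ℕ)

/-- Odd moments vanish under `y ↦ -y`. This makes the coefficients of `truncMGF` nonnegative, on
which both of its upper bounds rest. -/
lemma sum_signs_pow_nonneg (j : ℕ) : 0 ≤ ∑ y : Fin n → ℤˣ, (∑ i, ((y i : ℤ) : ℝ)) ^ j := by
  rcases j.even_or_odd with h | h
  · exact Finset.sum_nonneg fun y _ => h.pow_nonneg _
  · have e : ∑ y : Fin n → ℤˣ, (∑ i, ((y i : ℤ) : ℝ)) ^ j =
        ∑ y : Fin n → ℤˣ, -(∑ i, ((y i : ℤ) : ℝ)) ^ j :=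
      Fintype.sum_equiv (Equiv.neg _) _ _ fun y => by
        simp [Finset.sum_neg_distrib, h.neg_pow]
    rw [Finset.sum_neg_distrib] at e
    linarith

lemma sum_signs_exp (x : ℝ) :
    ∑ y : Fin n → ℤˣ, Real.exp (x * ∑ i, ((y i : ℤ) : ℝ)) = (2 * Real.cosh x) ^ n := by
  have h := Finset.prod_univ_sum (fun _ : Fin n => (Finset.univ : Finset ℤˣ))
    fun _ u => Real.exp (x * ((u : ℤ) : ℝ))
  rw [Fintype.piFinset_univ] at h
  simp_rw [Finset.mul_sum, Real.exp_sum]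
  rw [← h, Finset.prod_const, Finset.card_univ, Fintype.card_fin, Real.cosh_eq]
  congr 1
  rw [show (Finset.univ : Finset ℤˣ) = {1, -1} from rfl, Finset.sum_pair (by decide)]
  simp
  ring

/-- The degree-`d` moment of `ℓ` plus a sum of `n` independent signs. -/
noncomputable def signMoment (ℓ : ℝ) (d : ℕ) : ℝ :=
  (2 ^ n : ℝ)⁻¹ * ∑ y : Fin n → ℤˣ, (ℓ + ∑ i, ((y i : ℤ) : ℝ)) ^ d

lemma signMoment_nonneg {ℓ : ℝ} (hℓ : 0 ≤ ℓ) (d : ℕ) : 0 ≤ signMoment n ℓ d := by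
  refine mul_nonneg (by positivity) ?_
  simp_rw [add_pow]
  rw [Finset.sum_comm]
  refine Finset.sum_nonneg fun j _ => ?_
  simp_rw [mul_right_comm _ _ (_ : ℝ)]
  rw [← Finset.mul_sum]
  exact mul_nonneg (by positivity) (sum_signs_pow_nonneg n _)

/-- The truncated moment generating function of `ℓ` plus a sum of `n` independent signs. -/
noncomputable def truncMGF (N : ℕ) (ℓ x : ℝ) : ℝ :=
  ∑ d ∈ Finset.range (N + 1), signMoment n ℓ d * x ^ d / d.factorial

lemma truncMGF_nonneg (N : ℕ) {ℓ x : ℝ} (hℓ : 0 ≤ ℓ) (hx : 0 ≤ x) : 0 ≤ truncMGF n N ℓ x :=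
  Finset.sum_nonneg fun d _ => by
    have := signMoment_nonneg n hℓ d
    positivity

/-- The only place where the degree bound helps: a polynomial of degree at most `N` with nonnegative
coefficients grows at most like `t ^ N` under dilation. -/
lemma truncMGF_mul_le (N : ℕ) {ℓ x t : ℝ} (hℓ : 0 ≤ ℓ) (hx : 0 ≤ x) (ht : 1 ≤ t) :
    truncMGF n N ℓ (t * x) ≤ t ^ N * truncMGF n N ℓ x := by
  rw [truncMGF, truncMGF, Finset.mul_sum]
  refine Finset.sum_le_sum fun d hd => ?_
  have h := signMoment_nonneg n hℓ d
  have ht' : t ^ d ≤ t ^ N :=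
    pow_le_pow_right₀ ht (Nat.lt_succ_iff.1 (Finset.mem_range.1 hd))
  calc signMoment n ℓ d * (t * x) ^ d / d.factorial
      = t ^ d * (signMoment n ℓ d * x ^ d / d.factorial) := by rw [mul_pow]; ring
    _ ≤ _ := mul_le_mul_of_nonneg_right ht' (by positivity)

/-- Nonnegative terms allow completing the series to the full moment generating function, which
factors over the signs; then `cosh x ≤ exp (x² / 2)`. -/
lemma truncMGF_le (N : ℕ) {ℓ x : ℝ} (hℓ : 0 ≤ ℓ) (hx : 0 ≤ x) :
    truncMGF n N ℓ x ≤ Real.exp (x * ℓ + n * x ^ 2 / 2) := by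
  have hs : HasSum (fun d : ℕ => signMoment n ℓ d * x ^ d / d.factorial)
      ((2 ^ n : ℝ)⁻¹ * ∑ y : Fin n → ℤˣ, Real.exp (x * (ℓ + ∑ i, ((y i : ℤ) : ℝ)))) := by
    have h := (hasSum_sum (s := Finset.univ) fun (y : Fin n → ℤˣ) _ =>
      NormedSpace.expSeries_div_hasSum_exp (x * (ℓ + ∑ i, ((y i : ℤ) : ℝ)))).mul_left
      (2 ^ n : ℝ)⁻¹
    simp_rw [← Real.exp_eq_exp_ℝ] at h
    refine h.congr_fun ?_
    intro d
    simp only [signMoment, mul_pow, mul_assoc, Finset.sum_mul, mul_div_assoc, Finset.sum_div]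
    congr 1
    exact Finset.sum_congr rfl fun y _ => by ring
  refine (sum_le_hasSum _ (fun d _ => ?_) hs).trans ?_
  · have := signMoment_nonneg n hℓ d
    positivity
  · simp_rw [mul_add, Real.exp_add]
    rw [← Finset.mul_sum, sum_signs_exp, mul_pow]
    have hc : Real.cosh x ^ n ≤ Real.exp (n * x ^ 2 / 2) := by
      rw [mul_div_assoc, Real.exp_nat_mul]
      exact pow_le_pow_left₀ (Real.cosh_pos x).le (Real.cosh_le_exp_half_sq x) n
    calc (2 ^ n : ℝ)⁻¹ * (Real.exp (x * ℓ) * (2 ^ n * Real.cosh x ^ n))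
        = Real.exp (x * ℓ) * Real.cosh x ^ n := by field_simp
      _ ≤ _ := mul_le_mul_of_nonneg_left hc (Real.exp_pos _).le

end Signs

/-! ### Reduction of the second moment to a sum over overlaps. -/

section SecondMoment

lemma sum_meanVec_mul (p k : ℕ) {lam : ℝ} (hlam : 0 ≤ lam) (S T : Finset (Fin p)) :
    ∑ j, meanVec p k lam S j * meanVec p k lam T j = (T ∩ S).card * (lam / k) := by
  have h : ∀ j, meanVec p k lam S j * meanVec p k lam T j =
      if j ∈ T ∩ S then lam / k else 0 := by
    intro j
    by_cases hS : j ∈ S <;> by_cases hT : j ∈ T <;>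
      simp only [meanVec, hS, hT, Finset.mem_inter, and_true, and_false, if_true, if_false,
        mul_zero, zero_mul]
    exact Real.mul_self_sqrt (by positivity)
  simp_rw [h]
  rw [Finset.sum_ite_mem, Finset.univ_inter, Finset.sum_const, nsmul_eq_mul]

lemma sum_signal_mul (p k L n : ℕ) {lam : ℝ} (hlam : 0 ≤ lam) (S T : Finset (Fin p))
    (y z : Fin n → ℤˣ) :
    ∑ i, signal p k L n lam S y i * signal p k L n lam T z i =
      (L + ∑ i, (((y * z) i : ℤ) : ℝ)) * ((T ∩ S).card * (lam / k)) := by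
  rw [Fintype.sum_prod_type, Fintype.sum_sum_type]
  have h : ∀ i : Fin n, ∑ j, (((y i : ℤ) : ℝ) * meanVec p k lam S j) *
      (((z i : ℤ) : ℝ) * meanVec p k lam T j) =
      (((y * z) i : ℤ) : ℝ) * ((T ∩ S).card * (lam / k)) := by
    intro i
    rw [← sum_meanVec_mul p k hlam S T, Finset.mul_sum]
    refine Finset.sum_congr rfl fun j _ => ?_
    rw [Pi.mul_apply, Units.val_mul, Int.cast_mul, mul_mul_mul_comm]
  simp only [signal, sum_meanVec_mul p k hlam, h]
  rw [add_mul, Finset.sum_mul, Finset.sum_const, Finset.card_univ, Fintype.card_fin,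
    nsmul_eq_mul]

/-- Second moment of the projected likelihood ratio, bounded by a sum over the overlap. -/
lemma secondMoment_le {p k L n N : ℕ} (hp : 0 < p) (hkp : k ≤ p) {lam : ℝ} (hlam : 0 ≤ lam)
    (Ω : Finset (Finset (Fin p) × (Fin n → ℤˣ)))
    (hΩ : Ω = (Finset.univ : Finset (Fin p)).powersetCard k ×ˢ Finset.univ) :
    (Ω.card : ℝ)⁻¹ * ∑ ω ∈ Ω, ((Ω.card : ℝ)⁻¹ * ∑ ω' ∈ Ω, ∑ d ∈ Finset.range (N + 1),
      (∑ i, signal p k L n lam ω.1 ω.2 i * signal p k L n lam ω'.1 ω'.2 i) ^ d / d.factorial) ≤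
      ∑ t ∈ Finset.range (k + 1), ((k : ℝ) ^ 2 / p) ^ t / t.factorial *
        truncMGF n N L (t * (lam / k)) := by
  set P := (Finset.univ : Finset (Fin p)).powersetCard k with hP
  have hPc : P.card = p.choose k := by rw [hP, Finset.card_powersetCard]; simp
  have hPpos : (0 : ℝ) < P.card := by rw [hPc]; exact_mod_cast Nat.choose_pos hkp
  have hΩc : (Ω.card : ℝ) = P.card * 2 ^ n := by
    rw [hΩ, Finset.card_product, Finset.card_univ]; simp
  have hΩpos : (0 : ℝ) < Ω.card := by rw [hΩc]; positivity
  set B := ∑ t ∈ Finset.range (k + 1), ((k : ℝ) ^ 2 / p) ^ t / t.factorial *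
        truncMGF n N L (t * (lam / k)) with hB
  have hin : ∀ ω ∈ Ω, (Ω.card : ℝ)⁻¹ * ∑ ω' ∈ Ω, ∑ d ∈ Finset.range (N + 1),
      (∑ i, signal p k L n lam ω.1 ω.2 i * signal p k L n lam ω'.1 ω'.2 i) ^ d / d.factorial ≤
      B := by
    rintro ⟨T, z⟩ hω
    have hT : T.card = k := by
      rw [hΩ, Finset.mem_product] at hω
      exact (Finset.mem_powersetCard.1 hω.1).2
    have hS : ∀ S : Finset (Fin p), (2 ^ n : ℝ)⁻¹ * ∑ y : Fin n → ℤˣ,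
        ∑ d ∈ Finset.range (N + 1),
        (∑ i, signal p k L n lam T z i * signal p k L n lam S y i) ^ d / d.factorial =
        truncMGF n N L ((T ∩ S).card * (lam / k)) := by
      intro S
      rw [Finset.sum_comm, Finset.mul_sum, truncMGF]
      refine Finset.sum_congr rfl fun d _ => ?_
      rw [signMoment, ← Finset.sum_div, ← mul_div_assoc, mul_assoc, Finset.sum_mul]
      congr 2
      -- Only the product of the two sign vectors matters, and `y ↦ z * y` preserves the uniform
      -- law, so `z` disappears.
      refine Fintype.sum_equiv (Equiv.mulLeft z) _ _ fun y => ?_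
      rw [sum_signal_mul p k L n hlam, mul_pow, Finset.inter_comm]
      simp
    calc _ = (P.card : ℝ)⁻¹ * ∑ S ∈ P, truncMGF n N L ((T ∩ S).card * (lam / k)) := by
          rw [hΩc, hΩ, Finset.sum_product, mul_inv, mul_assoc, Finset.mul_sum]
          congr 1
          exact Finset.sum_congr rfl fun S _ => hS S
      _ = (P.card : ℝ)⁻¹ * ∑ t ∈ Finset.range (k + 1),
            (P.filter fun S => (T ∩ S).card = t).card * truncMGF n N L (t * (lam / k)) := by
          congr 1
          rw [← Finset.sum_fiberwise_of_maps_to (t := Finset.range (k + 1))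
            (g := fun S => (T ∩ S).card)]
          · refine Finset.sum_congr rfl fun t _ => ?_
            rw [Finset.sum_congr rfl (g := fun _ => truncMGF n N L (t * (lam / k))),
              Finset.sum_const, nsmul_eq_mul]
            intro S hS
            rw [(Finset.mem_filter.1 hS).2]
          · intro S _
            rw [Finset.mem_range, Nat.lt_succ_iff, ← hT]
            exact Finset.card_le_card Finset.inter_subset_left
      _ ≤ (P.card : ℝ)⁻¹ * ∑ t ∈ Finset.range (k + 1),
            P.card * (((k : ℝ) ^ 2 / p) ^ t / t.factorial) *
              truncMGF n N L (t * (lam / k)) := by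
          refine mul_le_mul_of_nonneg_left (Finset.sum_le_sum fun t ht => ?_) (by positivity)
          refine mul_le_mul_of_nonneg_right ?_
            (truncMGF_nonneg n N (Nat.cast_nonneg _) (by positivity))
          rw [hPc]
          exact card_filter_card_inter_le hp (Nat.lt_succ_iff.1 (Finset.mem_range.1 ht)) hkp hT
      _ = B := by
          simp_rw [mul_assoc]
          rw [← Finset.mul_sum, inv_mul_cancel_left₀ hPpos.ne']
  calc _ ≤ (Ω.card : ℝ)⁻¹ * ∑ ω ∈ Ω, B :=
        mul_le_mul_of_nonneg_left (Finset.sum_le_sum hin) (by positivity)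
    _ = B := by rw [Finset.sum_const, nsmul_eq_mul, inv_mul_cancel_left₀ hΩpos.ne']

end SecondMoment

/-! ### Estimates on the overlap sum for large `p`. -/

section Asymptotic

lemma overlap_term_le {α β γ lam c₁ c₂ : ℝ} {p k L n N t : ℕ}
    (hα : α < 1 / 2) (hβ : β < 1 / 2 - α) (hγ : γ < 2) (hlam : 0 < lam)
    (hc₂ : 0 ≤ c₂) (hk1 : 1 ≤ k) (hkp : k ≤ p) (hk : (k : ℝ) ≤ c₁ * (p : ℝ) ^ α)
    (hn : n * lam ^ 2 ≤ c₂ * (k : ℝ) ^ γ) (hL : lam / k * L ≤ 2 * β * Real.log p)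
    (hN : (N : ℝ) ≤ Real.log p ^ 2)
    (hK : Real.log p ^ 2 + 2 * β ≤ (1 - 2 * α) * (k : ℝ) ^ (2 - γ)) (htk : t ≤ k) :
    ((k : ℝ) ^ 2 / p) ^ t / t.factorial * truncMGF n N L (t * (lam / k)) ≤
      Real.exp (c₂ / 2) * ((c₁ ^ 2 * Real.exp (c₂ / 2)) ^ t / t.factorial) := by
  set x := Real.log p with hx
  set K := (k : ℝ) ^ (2 - γ) with hKdef
  have hk0 : (0 : ℝ) < k := by exact_mod_cast hk1
  have hk1' : (1 : ℝ) ≤ k := by exact_mod_cast hk1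
  have hp0 : (0 : ℝ) < p := by exact_mod_cast hk1.trans hkp
  have hx0 : 0 ≤ x := Real.log_nonneg (by exact_mod_cast hk1.trans hkp)
  have hK1 : 1 ≤ K := Real.one_le_rpow hk1' (by linarith)
  have hK0 : 0 < K := by linarith
  have hKγ : K * (k : ℝ) ^ γ = (k : ℝ) ^ 2 := by
    rw [hKdef, ← Real.rpow_add hk0, sub_add_cancel]; norm_num
  have hbase : (k : ℝ) ^ 2 / p ≤ c₁ ^ 2 * Real.exp (-((1 - 2 * α) * x)) := by
    have h1 : (k : ℝ) ^ 2 ≤ c₁ ^ 2 * Real.exp (2 * α * x) := by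
      have h2 : (p : ℝ) ^ α = Real.exp (α * x) := by
        rw [Real.rpow_def_of_pos hp0, mul_comm]
      rw [h2] at hk
      calc (k : ℝ) ^ 2 ≤ (c₁ * Real.exp (α * x)) ^ 2 := pow_le_pow_left₀ hk0.le hk 2
        _ = c₁ ^ 2 * Real.exp (2 * α * x) := by
          rw [mul_pow, ← Real.exp_nat_mul]; congr 2; push_cast; ring
    have e : Real.exp (-((1 - 2 * α) * x)) * p = Real.exp (2 * α * x) := by
      have hpx : (p : ℝ) = Real.exp x := (Real.exp_log hp0).symm
      rw [hpx, ← Real.exp_add]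
      congr 1
      ring
    rwa [div_le_iff₀ hp0, mul_assoc, e]
  have hpow : ((k : ℝ) ^ 2 / p) ^ t ≤ (c₁ ^ 2) ^ t * Real.exp (-((1 - 2 * α) * x) * t) := by
    refine (pow_le_pow_left₀ (by positivity) hbase t).trans_eq ?_
    rw [mul_pow, ← Real.exp_nat_mul, mul_comm (t : ℝ)]
  have hvar : n * (lam / k) ^ 2 ≤ c₂ / K := by
    rw [div_pow, le_div_iff₀ hK0, ← mul_div_assoc, div_mul_eq_mul_div,
      div_le_iff₀ (by positivity)]
    calc n * lam ^ 2 * K ≤ c₂ * (k : ℝ) ^ γ * K := mul_le_mul_of_nonneg_right hn hK0.le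
      _ = c₂ * (k : ℝ) ^ 2 := by rw [← hKγ]; ring
  have hL0 : (0 : ℝ) ≤ L := Nat.cast_nonneg _
  -- The exponent `(1 - 2α) x t` is exactly what `hpow` can cancel.
  have hF : truncMGF n N L (t * (lam / k)) ≤
      Real.exp ((1 - 2 * α) * x * t + c₂ / 2 * t + c₂ / 2) := by
    -- By `hvar`, the variance term is at most `c₂ t² / (2K)`, which is linear in `t` precisely when
    -- `t ≤ K`.
    rcases le_total (t : ℝ) K with h | h
    · refine (truncMGF_le n N hL0 (by positivity)).trans (Real.exp_le_exp.2 ?_)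
      have ht0 : (0 : ℝ) ≤ t := Nat.cast_nonneg _
      have h1 : t * (lam / k) * L ≤ 2 * β * x * t := by
        calc t * (lam / k) * L = t * (lam / k * L) := by ring
          _ ≤ t * (2 * β * x) := mul_le_mul_of_nonneg_left hL ht0
          _ = _ := by ring
      have h2 : n * (t * (lam / k)) ^ 2 / 2 ≤ c₂ / 2 * t := by
        have h3 : c₂ / K * t ^ 2 ≤ c₂ * t := by
          rw [div_mul_eq_mul_div, div_le_iff₀ hK0]
          calc c₂ * (t : ℝ) ^ 2 = c₂ * t * t := by ring
            _ ≤ c₂ * t * K := mul_le_mul_of_nonneg_left h (by positivity)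
        calc n * (t * (lam / k)) ^ 2 / 2 = n * (lam / k) ^ 2 * t ^ 2 / 2 := by ring
          _ ≤ c₂ / K * t ^ 2 / 2 := by gcongr
          _ ≤ c₂ / 2 * t := by linarith
      have h4 : 2 * β * x * t ≤ (1 - 2 * α) * x * t := by
        have : 2 * β ≤ 1 - 2 * α := by linarith
        gcongr
      linarith
    -- Large overlap: `t` is pulled out by dilation, leaving argument `λ/k`; `hK` then pays for `t ^
    -- N` and the labelled samples out of `(1 - 2α) x K`.
    · have ht1 : (1 : ℝ) ≤ t := hK1.trans h
      have ht0 : (0 : ℝ) < t := by linarith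
      refine (truncMGF_mul_le n N hL0 (by positivity) ht1).trans ?_
      have h1 : (t : ℝ) ^ N ≤ Real.exp (x ^ 2 * x) := by
        rw [← Real.exp_log ht0, ← Real.exp_nat_mul]
        refine Real.exp_le_exp.2 ?_
        have : Real.log t ≤ x := Real.log_le_log ht0 (by exact_mod_cast htk.trans hkp)
        exact mul_le_mul hN this (Real.log_nonneg ht1) (sq_nonneg x)
      have h2 : truncMGF n N L (lam / k) ≤ Real.exp (2 * β * x + c₂ / 2) := by
        refine (truncMGF_le n N hL0 (by positivity)).trans (Real.exp_le_exp.2 ?_)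
        have : c₂ / K ≤ c₂ := div_le_self hc₂ hK1
        linarith
      refine (mul_le_mul h1 h2 (truncMGF_nonneg n N hL0 (by positivity))
        (Real.exp_pos _).le).trans ?_
      rw [← Real.exp_add]
      refine Real.exp_le_exp.2 ?_
      have h5 : (x ^ 2 + 2 * β) * x ≤ (1 - 2 * α) * K * x := mul_le_mul_of_nonneg_right hK hx0
      have h6 : (1 - 2 * α) * x * K ≤ (1 - 2 * α) * x * t :=
        mul_le_mul_of_nonneg_left h (mul_nonneg (by linarith) hx0)
      have h7 : 0 ≤ c₂ / 2 * t := by positivity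
      linarith
  calc ((k : ℝ) ^ 2 / p) ^ t / t.factorial * truncMGF n N L (t * (lam / k))
      ≤ (c₁ ^ 2) ^ t * Real.exp (-((1 - 2 * α) * x) * t) / t.factorial *
          Real.exp ((1 - 2 * α) * x * t + c₂ / 2 * t + c₂ / 2) := by
        gcongr
        exact truncMGF_nonneg n N hL0 (by positivity)
    _ = (c₁ ^ 2) ^ t / t.factorial * (Real.exp (-((1 - 2 * α) * x) * t) *
          Real.exp ((1 - 2 * α) * x * t + c₂ / 2 * t + c₂ / 2)) := by ring
    _ = (c₁ ^ 2) ^ t / t.factorial * (Real.exp (c₂ / 2) * Real.exp (c₂ / 2) ^ t) := by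
        rw [← Real.exp_add, ← Real.exp_nat_mul, ← Real.exp_add]
        congr 2; ring
    _ = _ := by rw [mul_pow]; ring

lemma overlap_sum_le {α β γ lam c₁ c₂ : ℝ} {p k L n N : ℕ}
    (hα : α < 1 / 2) (hβ : β < 1 / 2 - α) (hγ : γ < 2) (hlam : 0 < lam)
    (hc₂ : 0 ≤ c₂) (hk1 : 1 ≤ k) (hkp : k ≤ p) (hk : (k : ℝ) ≤ c₁ * (p : ℝ) ^ α)
    (hn : n * lam ^ 2 ≤ c₂ * (k : ℝ) ^ γ) (hL : lam / k * L ≤ 2 * β * Real.log p)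
    (hN : (N : ℝ) ≤ Real.log p ^ 2)
    (hK : Real.log p ^ 2 + 2 * β ≤ (1 - 2 * α) * (k : ℝ) ^ (2 - γ)) :
    ∑ t ∈ Finset.range (k + 1), ((k : ℝ) ^ 2 / p) ^ t / t.factorial *
        truncMGF n N L (t * (lam / k)) ≤
      Real.exp (c₂ / 2) * Real.exp (c₁ ^ 2 * Real.exp (c₂ / 2)) := by
  refine (Finset.sum_le_sum fun t ht => overlap_term_le hα hβ hγ hlam hc₂ hk1 hkp hk hn hL hN hK
    (Nat.lt_succ_iff.1 (Finset.mem_range.1 ht))).trans ?_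
  rw [← Finset.mul_sum]
  exact mul_le_mul_of_nonneg_left (Real.sum_le_exp_of_nonneg (by positivity) _)
    (Real.exp_pos _).le

lemma eventually_support_size {α β γ c₁ : ℝ} (hα : 0 < α) (hα' : α < 1 / 2) (hγ : γ < 2)
    (hc₁ : 0 < c₁) :
    ∀ᶠ p : ℕ in atTop, 1 ≤ ⌊c₁ * (p : ℝ) ^ α⌋₊ ∧ ⌊c₁ * (p : ℝ) ^ α⌋₊ ≤ p ∧
      Real.log p ^ 2 + 2 * β ≤ (1 - 2 * α) * (⌊c₁ * (p : ℝ) ^ α⌋₊ : ℝ) ^ (2 - γ) := by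
  have hε : 0 < 2 - γ := by linarith
  -- The value `2` ensures that taking the floor loses at most half, as `hlow` needs.
  have h1 : ∀ᶠ x : ℝ in atTop, 2 ≤ c₁ * x ^ α :=
    ((tendsto_rpow_atTop hα).const_mul_atTop hc₁).eventually_ge_atTop 2
  have h2 : ∀ᶠ x : ℝ in atTop, c₁ * x ^ α ≤ x := by
    filter_upwards [(tendsto_rpow_atTop (show 0 < 1 - α by linarith)).eventually_ge_atTop c₁,
      eventually_gt_atTop 0] with x hx hx0
    calc c₁ * x ^ α ≤ x ^ (1 - α) * x ^ α :=
          mul_le_mul_of_nonneg_right hx (Real.rpow_nonneg hx0.le _)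
      _ = x := by rw [← Real.rpow_add hx0, sub_add_cancel, Real.rpow_one]
  have h3 : ∀ᶠ x : ℝ in atTop,
      Real.log x ^ 2 + 2 * β ≤ (1 - 2 * α) * (c₁ / 2) ^ (2 - γ) * x ^ (α * (2 - γ)) := by
    have hc : 0 < (1 - 2 * α) * (c₁ / 2) ^ (2 - γ) :=
      mul_pos (by linarith) (Real.rpow_pos_of_pos (by linarith) _)
    have hs : 0 < α * (2 - γ) := mul_pos hα hε
    -- Half of the constant absorbs `log²`, the other half absorbs `2β`.
    have ha := (isLittleO_log_rpow_rpow_atTop 2 hs).bound (half_pos hc)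
    have hb := (tendsto_rpow_atTop hs).const_mul_atTop (half_pos hc)
    filter_upwards [ha, hb.eventually_ge_atTop (2 * β), eventually_ge_atTop 1] with x hx hx' hx1
    have hl := Real.log_nonneg hx1
    rw [Real.norm_of_nonneg (by positivity), Real.norm_of_nonneg (by positivity),
      Real.rpow_two] at hx
    linarith
  filter_upwards [tendsto_natCast_atTop_atTop.eventually h1,
    tendsto_natCast_atTop_atTop.eventually h2,
    tendsto_natCast_atTop_atTop.eventually h3] with p hp1 hp2 hp3
  have hlow : c₁ / 2 * (p : ℝ) ^ α ≤ (⌊c₁ * (p : ℝ) ^ α⌋₊ : ℝ) := by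
    have := Nat.lt_floor_add_one (c₁ * (p : ℝ) ^ α)
    linarith
  refine ⟨Nat.le_floor (by push_cast; linarith), Nat.floor_le_of_le hp2, hp3.trans ?_⟩
  rw [mul_assoc]
  refine mul_le_mul_of_nonneg_left ?_ (by linarith)
  rw [Real.rpow_mul (Nat.cast_nonneg _), ← Real.mul_rpow (by positivity) (by positivity)]
  exact Real.rpow_le_rpow (by positivity) hlow hε.le

end Asymptotic

/-! ### Assembly: the alternative as a uniform mixture, and the theorem. -/

lemma altDist_eq (p k L n : ℕ) (lam : ℝ) (Ω : Finset (Finset (Fin p) × (Fin n → ℤˣ)))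
    (hΩ : Ω = (Finset.univ : Finset (Fin p)).powersetCard k ×ˢ Finset.univ) :
    altDist p k L n lam = (Ω.card : ℝ≥0∞)⁻¹ • ∑ ω ∈ Ω, (gaussPi (DataIdx p L n)).map
      (fun ξ => signal p k L n lam ω.1 ω.2 + ξ) := by
  have hc : Ω.card = p.choose k * 2 ^ n := by
    rw [hΩ, Finset.card_product, Finset.card_powersetCard]; simp
  rw [altDist, hc, hΩ, Finset.sum_product]
  rfl

end LowDegree

open LowDegree in
theorem mainTheorem2 (α β γ lam c₁ c₂ : ℝ)
    (hα : 0 < α) (hα' : α < 1 / 2) (hβ : 0 ≤ β) (hγ : 0 ≤ γ)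
    (hlam : 0 < lam) (hc₁ : 0 < c₁) (hc₂ : 0 ≤ c₂)
    (hβ' : β < 1 / 2 - α) (hγ' : γ < 2)
    (k L n : ℕ → ℕ) (D : ℕ → ℝ)
    (hk : ∀ p : ℕ, k p = ⌊c₁ * (p : ℝ) ^ α⌋₊)
    (hL : ∀ p : ℕ, L p = ⌊2 * β * (k p : ℝ) / lam * Real.log ((p : ℝ) - (k p : ℝ))⌋₊)
    (hn : ∀ p : ℕ, n p = ⌊c₂ * ((k p : ℝ) ^ γ / lam ^ 2)⌋₊)
    (hD : ∀ p : ℕ, D p = (Real.log (p : ℝ)) ^ 2) :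
    -- for all large `p` the maximum that defines the norm is attained
    (∀ᶠ p : ℕ in atTop,
      IsGreatest
        (lowDegreeRatios (altDist p (k p) (L p) (n p) lam) (nullDist p (L p) (n p)) (D p))
        (lowDegreeNorm (altDist p (k p) (L p) (n p) lam) (nullDist p (L p) (n p)) (D p))) ∧
    (fun p : ℕ =>
        (lowDegreeNorm (altDist p (k p) (L p) (n p) lam) (nullDist p (L p) (n p)) (D p)) ^ 2)
      =O[atTop] (fun _ : ℕ => (1 : ℝ)) := by
  have key : ∀ᶠ p : ℕ in atTop, ∃ r : ℝ,
      IsGreatest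
        (lowDegreeRatios (altDist p (k p) (L p) (n p) lam) (nullDist p (L p) (n p)) (D p)) r ∧
      r ^ 2 ≤ Real.exp (c₂ / 2) * Real.exp (c₁ ^ 2 * Real.exp (c₂ / 2)) := by
    filter_upwards [eventually_support_size (β := β) hα hα' hγ' hc₁] with p hp
    rw [← hk p] at hp
    obtain ⟨hk1, hkp, hK⟩ := hp
    have hk0 : (0 : ℝ) < k p := by exact_mod_cast hk1
    set Ω := (Finset.univ : Finset (Fin p)).powersetCard (k p) ×ˢ
      (Finset.univ : Finset (Fin (n p) → ℤˣ)) with hΩ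
    have hne : Ω.Nonempty :=
      (Finset.powersetCard_nonempty.2 (by simpa using hkp)).product Finset.univ_nonempty
    have hD0 : 0 ≤ D p := by rw [hD]; positivity
    have hg := isGreatest_lowDegreeRatios Ω
      (fun ω => signal p (k p) (L p) (n p) lam ω.1 ω.2) hne hD0
    rw [← altDist_eq p (k p) (L p) (n p) lam Ω hΩ] at hg
    refine ⟨_, hg, ?_⟩
    rw [Real.sq_sqrt (integral_nonneg fun x => sq_nonneg _), integral_mixtureLR_sq]
    refine (secondMoment_le (by omega) hkp hlam.le Ω hΩ).trans ?_
    refine overlap_sum_le hα' hβ' hγ' hlam hc₂ hk1 hkp ?_ ?_ ?_ ?_ hK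
    · rw [hk]
      exact Nat.floor_le (by positivity)
    · have h : (n p : ℝ) ≤ c₂ * ((k p : ℝ) ^ γ / lam ^ 2) := by
        rw [hn p]; exact Nat.floor_le (by positivity)
      rwa [← mul_div_assoc, le_div_iff₀ (by positivity)] at h
    · have hlog0 : 0 ≤ Real.log ((p : ℝ) - k p) := by
        rw [← Nat.cast_sub hkp]; exact Real.log_natCast_nonneg _
      have hlog : Real.log ((p : ℝ) - k p) ≤ Real.log p := by
        -- If `k = p`, the logarithm is `log 0 = 0` by convention and the bound still holds.
        rcases hkp.eq_or_lt with h | h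
        · rw [h, sub_self, Real.log_zero]; exact Real.log_natCast_nonneg _
        · exact Real.log_le_log (sub_pos.2 (by exact_mod_cast h)) (by linarith)
      have h : (L p : ℝ) ≤ 2 * β * (k p : ℝ) / lam * Real.log ((p : ℝ) - (k p : ℝ)) := by
        rw [hL p]; exact Nat.floor_le (by positivity)
      calc lam / k p * L p
          ≤ lam / k p * (2 * β * (k p : ℝ) / lam * Real.log ((p : ℝ) - (k p : ℝ))) :=
            mul_le_mul_of_nonneg_left h (by positivity)
        _ = 2 * β * Real.log ((p : ℝ) - (k p : ℝ)) := by field_simp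
        _ ≤ 2 * β * Real.log p := mul_le_mul_of_nonneg_left hlog (by positivity)
    · rw [← hD p]
      exact Nat.floor_le hD0
  constructor
  · filter_upwards [key] with p ⟨r, hr, _⟩
    rwa [lowDegreeNorm, hr.csSup_eq]
  · refine IsBigO.of_bound (Real.exp (c₂ / 2) * Real.exp (c₁ ^ 2 * Real.exp (c₂ / 2))) ?_
    filter_upwards [key] with p ⟨r, hr, hb⟩
    rw [lowDegreeNorm, hr.csSup_eq, norm_one, mul_one, Real.norm_of_nonneg (sq_nonneg r)]
    exact hb
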